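/- Let $\mathbb{K}$ be a field. For a finite simple graph $H$ with vertex set $V$, the edge ideal $I(H)\subseteq S=\mathbb{K}[x_v : v\in V]$ is generated by the monomials $x_ux_v$ with $uv$ an edge of $H$. For an ideal $I\subseteq S$ and $s\ge 1$ let $I^{(s)}=\bigcap_{P\in \mathrm{Ass}(S/I)}(I^sS_P\cap S)$ be its $s$-th symbolic power, and, with $s,r$ ranging over the positive integers, let \[ \rho(I)=\sup\left\{\frac{s}{r} : I^{(s)}\not\subseteq I^r\right\},\qquad \rho_a(I)=\sup\left\{\frac{s}{r} : I^{(st)}\not\subseteq I^{rt}\ \text{for all } t\gg 0\right\} \] be its resurgence and asymptotic resurgence. Proposition. Suppose $G$ is a simple graph obtained as a disjoint union of two odd cycles $C_1$ and $C_2$, of lengths $n$ and $m$ respectively, where $3\le n<m$. Then \[ \rho(I(G))=\rho_a(I(G))=\rho(I(C_1))=\frac{n+1}{n}, \] where $I(C_1)$ may be taken either in the polynomial ring on the vertices of $C_1$ or in the polynomial ring on all the vertices of $G$. -/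

import Mathlib

open Filter

noncomputable section

/-- The edge ideal of a simple graph: the ideal of `K[x_v : v ∈ V]` generated by the monomials
`x_u x_v` for the edges `uv` of the graph. -/
def edgeIdeal (K : Type*) [Field K] {V : Type*} (G : SimpleGraph V) : Ideal (MvPolynomial V K) :=
  Ideal.span {f | ∃ u v : V, G.Adj u v ∧ f = MvPolynomial.X u * MvPolynomial.X v}

/-- The contraction `J R_P ∩ R` to `R` of the extension of the ideal `J` to the localization of
`R` at the prime ideal `P`. -/
def localContraction {R : Type*} [CommRing R] (J P : Ideal R) [P.IsPrime] : Ideal R :=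
  (J.map (algebraMap R (Localization.AtPrime P))).comap (algebraMap R (Localization.AtPrime P))

/-- The `s`-th symbolic power `I^(s) = ⋂_{P ∈ Ass(R/I)} (I^s R_P ∩ R)`. -/
def symbolicPower {R : Type*} [CommRing R] (I : Ideal R) (s : ℕ) : Ideal R :=
  ⨅ (P : Ideal R) (hP : P ∈ associatedPrimes R (R ⧸ I)),
    haveI : P.IsPrime := hP.isPrime
    localContraction (I ^ s) P

/-- The resurgence `ρ(I) = sup {s / r : I^(s) ⊄ I^r}`, with `s`, `r` positive integers, as an
extended real number. -/
def resurgence {R : Type*} [CommRing R] (I : Ideal R) : EReal :=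
  sSup {q : EReal | ∃ s r : ℕ, 0 < s ∧ 0 < r ∧ ¬ symbolicPower I s ≤ I ^ r ∧
    q = (((s : ℝ) / (r : ℝ) : ℝ) : EReal)}

/-- The asymptotic resurgence `ρ_a(I) = sup {s / r : I^(st) ⊄ I^(rt) for all t ≫ 0}`, where on the
right `I^(rt)` is the ordinary power, with `s`, `r` positive integers, as an extended real
number. -/
def asymptoticResurgence {R : Type*} [CommRing R] (I : Ideal R) : EReal :=
  sSup {q : EReal | ∃ s r : ℕ, 0 < s ∧ 0 < r ∧
    (∀ᶠ t : ℕ in atTop, ¬ symbolicPower I (s * t) ≤ I ^ (r * t)) ∧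
    q = (((s : ℝ) / (r : ℝ) : ℝ) : EReal)}

/-- A graph is a cycle of length `n` if `3 ≤ n` and it is isomorphic to the standard cycle graph
on `n` vertices. -/
def IsCycleOfLength {V : Type*} (C : SimpleGraph V) (n : ℕ) : Prop :=
  3 ≤ n ∧ Nonempty (C ≃g SimpleGraph.cycleGraph n)

end

open MvPolynomial

/-! Every monomial occurring in an element of I^(s) has weight at least s on each vertex cover,
because minimal covers give associated primes. Conversely, `exists_monomial_mem_pow` shows that such
a monomial is divisible by a product of r edges and of powers a_i of the cycle products (the product
of the variables on a cycle of length 2k_i + 1), with s ≤ r + Σ a_i (k_i + 1).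

The square of a cycle product is a product of 2k_i + 1 edges, so its a-th power lies in the ordinary
power of I with exponent k_i a + ⌊a/2⌋. Each cycle loses at most 1/2 to rounding, two cycles at most
1, and the ratio (2k_i + 2)/(2k_i + 1) is largest on the shortest cycle, of length n. Hence I^(s) ⊆
I^r as soon as r(n + 1) < sn.

For sharpness, the 2u-th power of the shortest cycle product lies in I^((n+1)u), but its degree 2nu
keeps it out of I^r when r > nu. This family survives scaling by t, so both resurgences equal (n +
1)/n. -/

/-! ### Elementwise descriptions of associated primes and symbolic powers. -/

theorem exists_mem_iff_mul_mem_of_mem_associatedPrimes {R : Type*} [CommRing R]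
    [IsNoetherianRing R] {I P : Ideal R} (hP : P ∈ associatedPrimes R (R ⧸ I)) :
    ∃ f, ∀ h, h ∈ P ↔ h * f ∈ I := by
  obtain ⟨-, x, hx⟩ := (isAssociatedPrime_iff (R := R)).mp hP
  obtain ⟨f, rfl⟩ := Ideal.Quotient.mk_surjective x
  refine ⟨f, fun h => ?_⟩
  rw [hx, Submodule.mem_colon_singleton, Submodule.mem_bot, ← Ideal.Quotient.eq_zero_iff_mem,
    map_mul]
  rfl

theorem mem_associatedPrimes_quotient {R : Type*} [CommRing R] [IsNoetherianRing R]
    {I P : Ideal R} [hP : P.IsPrime] (f : R) (hf : ∀ h, h ∈ P ↔ h * f ∈ I) :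
    P ∈ associatedPrimes R (R ⧸ I) := by
  refine (isAssociatedPrime_iff (R := R)).mpr ⟨hP, Ideal.Quotient.mk I f, ?_⟩
  ext h
  rw [hf, Submodule.mem_colon_singleton, Submodule.mem_bot, ← Ideal.Quotient.eq_zero_iff_mem,
    map_mul]
  rfl

theorem mem_localContraction_iff {R : Type*} [CommRing R] {J P : Ideal R} [hP : P.IsPrime]
    {f : R} : f ∈ localContraction J P ↔ ∃ g, g ∉ P ∧ g * f ∈ J := by
  rw [localContraction, Ideal.mem_comap,
    IsLocalization.algebraMap_mem_map_algebraMap_iff P.primeCompl]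
  rfl

theorem mem_symbolicPower_iff {R : Type*} [CommRing R] {I : Ideal R} {s : ℕ} {f : R} :
    f ∈ symbolicPower I s ↔
      ∀ P ∈ associatedPrimes R (R ⧸ I), ∃ g, g ∉ P ∧ g * f ∈ I ^ s := by
  simp only [symbolicPower, Submodule.mem_iInf]
  refine forall₂_congr fun P hP => ?_
  have : P.IsPrime := hP.isPrime
  exact mem_localContraction_iff

/-! ### Edge ideals, associated primes and vertex covers. -/

section

variable {K : Type*} [Field K] {V : Type*}

theorem X_mul_X_mem_edgeIdeal {G : SimpleGraph V} {u v : V} (h : G.Adj u v) :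
    (X u * X v : MvPolynomial V K) ∈ edgeIdeal K G :=
  Ideal.subset_span ⟨u, v, h, rfl⟩

theorem edgeIdeal_eq_span_monomial (G : SimpleGraph V) :
    edgeIdeal K G = Ideal.span ((fun s => monomial s (1 : K)) ''
      {e | ∃ u v, G.Adj u v ∧ e = Finsupp.single u 1 + Finsupp.single v 1}) := by
  rw [edgeIdeal]
  congr 1
  ext f
  simp only [Set.mem_ofPred_eq, Set.mem_image]
  constructor
  · rintro ⟨u, v, h, rfl⟩
    exact ⟨_, ⟨u, v, h, rfl⟩, by simp [X, monomial_mul]⟩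
  · rintro ⟨_, ⟨u, v, h, rfl⟩, rfl⟩
    exact ⟨u, v, h, by simp [X, monomial_mul]⟩

theorem mem_edgeIdeal_iff {G : SimpleGraph V} {f : MvPolynomial V K} :
    f ∈ edgeIdeal K G ↔ ∀ e ∈ f.support, ∃ u v, G.Adj u v ∧ e u ≠ 0 ∧ e v ≠ 0 := by
  classical
  rw [edgeIdeal_eq_span_monomial, mem_ideal_span_monomial_image]
  refine forall₂_congr fun e _ => ?_
  constructor
  · rintro ⟨_, ⟨u, v, h, rfl⟩, hle⟩
    have hu := hle u
    have hv := hle v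
    simp only [Finsupp.add_apply, Finsupp.single_apply] at hu hv
    exact ⟨u, v, h, by grind, by grind⟩
  · rintro ⟨u, v, h, hu, hv⟩
    refine ⟨_, ⟨u, v, h, rfl⟩, fun w => ?_⟩
    have := h.ne
    simp only [Finsupp.add_apply, Finsupp.single_apply]
    grind

/-- The variables in an associated prime form a minimal cover. If all neighbours of w were in P,
then for each monomial e of f either e is already in the ideal or e involves a neighbour u of w. In
the latter case multiplying by x_u does not enlarge the support, so e is again in the ideal; thus f
would be too. -/
theorem exists_adj_X_notMem_of_X_mem {G : SimpleGraph V} {P : Ideal (MvPolynomial V K)}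
    {f : MvPolynomial V K} (hf : ∀ h, h ∈ P ↔ h * f ∈ edgeIdeal K G) (hP : P ≠ ⊤) {w : V}
    (hw : X w ∈ P) : ∃ u, G.Adj w u ∧ X u ∉ P := by
  classical
  by_contra! hcon
  apply hP
  rw [Ideal.eq_top_iff_one, hf, one_mul, mem_edgeIdeal_iff]
  intro e he
  have key : ∀ u, X u ∈ P → ∃ a b, G.Adj a b ∧ (a = u ∨ e a ≠ 0) ∧ (b = u ∨ e b ≠ 0) := by
    intro u hu
    have h1 : e + Finsupp.single u 1 ∈ (X u * f).support := by
      rw [mem_support_iff, mul_comm, coeff_mul_X]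
      exact mem_support_iff.mp he
    obtain ⟨a, b, hab, ha, hb⟩ := mem_edgeIdeal_iff.mp ((hf _).mp hu) _ h1
    simp only [Finsupp.add_apply, Finsupp.single_apply] at ha hb
    exact ⟨a, b, hab, by grind, by grind⟩
  obtain ⟨a, b, hab, ha, hb⟩ := key w hw
  by_cases h : e a ≠ 0 ∧ e b ≠ 0
  · exact ⟨a, b, hab, h⟩
  have : ∃ u, G.Adj w u ∧ e u ≠ 0 := by
    have := hab.ne
    rcases ha with rfl | ha
    · exact ⟨b, hab, by grind⟩
    · rcases hb with rfl | hb
      · exact ⟨a, hab.symm, ha⟩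
      · exact absurd ⟨ha, hb⟩ h
  obtain ⟨u, hwu, hu⟩ := this
  obtain ⟨a, b, hab, ha, hb⟩ := key u (hcon u hwu)
  exact ⟨a, b, hab, by grind, by grind⟩

/-- The substitution `x_w ↦ T x_w` for `w ∈ W`. -/
noncomputable def scaleVars (K : Type*) [Field K] {V : Type*} (W : Finset V) :
    MvPolynomial V K →ₐ[K] Polynomial (MvPolynomial V K) :=
  open Classical in
  aeval fun v => if v ∈ W then Polynomial.X * Polynomial.C (X v) else Polynomial.C (X v)

theorem scaleVars_monomial (W : Finset V) (e : V →₀ ℕ) (a : K) :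
    scaleVars K W (monomial e a) = Polynomial.monomial (∑ w ∈ W, e w) (monomial e a) := by
  classical
  rw [scaleVars, aeval_monomial]
  have h : (e.prod fun i k => (if i ∈ W then Polynomial.X * Polynomial.C (X i)
      else Polynomial.C (X i : MvPolynomial V K)) ^ k) =
      Polynomial.X ^ (∑ w ∈ W, e w) * Polynomial.C (monomial e (1 : K)) := by
    rw [monomial_eq, C_1, one_mul, Finsupp.prod, Finsupp.prod, map_prod]
    have h2 : ∑ w ∈ W, e w = ∑ w ∈ e.support, if w ∈ W then e w else 0 := by
      rw [← Finset.sum_filter]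
      symm
      apply Finset.sum_subset_zero_on_sdiff
      · intro x hx
        exact (Finset.mem_filter.mp hx).2
      · intro x hx
        simp only [Finset.mem_sdiff, Finset.mem_filter, Finsupp.mem_support_iff] at hx
        tauto
      · intros; rfl
    rw [h2, ← Finset.prod_pow_eq_pow_sum, ← Finset.prod_mul_distrib]
    refine Finset.prod_congr rfl fun w _ => ?_
    split_ifs
    · rw [mul_pow, map_pow]
    · simp
  rw [h]
  have : algebraMap K (Polynomial (MvPolynomial V K)) a = Polynomial.C (C a) := rfl
  rw [this, ← Polynomial.C_mul_X_pow_eq_monomial, mul_left_comm, ← Polynomial.C_mul, C_mul_monomial,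
    mul_one, mul_comm]

/-- The W-weight becomes the order of vanishing in T, so primality of T can replace a study of
powers of the ideal generated by W. -/
theorem X_pow_dvd_scaleVars_iff {W : Finset V} {f : MvPolynomial V K} {s : ℕ} :
    Polynomial.X ^ s ∣ scaleVars K W f ↔ ∀ e ∈ f.support, s ≤ ∑ w ∈ W, e w := by
  classical
  have hf : scaleVars K W f =
      ∑ e ∈ f.support, Polynomial.monomial (∑ w ∈ W, e w) (monomial e (coeff e f)) := by
    conv_lhs => rw [f.as_sum, map_sum]
    simp only [scaleVars_monomial]
  constructor
  · intro h e he
    by_contra! hlt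
    have h0 := Polynomial.X_pow_dvd_iff.mp h _ hlt
    rw [hf, Polynomial.finsetSum_coeff] at h0
    have h1 := congrArg (coeff e) h0
    rw [coeff_sum, Finset.sum_eq_single e] at h1
    · simp at h1
      exact (mem_support_iff.mp he) h1
    · intro b _ hb
      rw [Polynomial.coeff_monomial]
      split_ifs
      · simp [coeff_monomial, hb]
      · simp
    · exact fun h => absurd he h
  · intro h
    rw [hf]
    refine Finset.dvd_sum fun e he => ?_
    rw [← Polynomial.C_mul_X_pow_eq_monomial]
    exact Dvd.dvd.mul_left (pow_dvd_pow _ (h e he)) _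

/-- A finite vertex cover of a graph. -/
def IsCover (G : SimpleGraph V) (W : Finset V) : Prop :=
  ∀ u v, G.Adj u v → u ∈ W ∨ v ∈ W

theorem X_dvd_scaleVars_of_mem {G : SimpleGraph V} {W : Finset V} (hW : IsCover G W)
    {f : MvPolynomial V K} (hf : f ∈ edgeIdeal K G) : Polynomial.X ∣ scaleVars K W f := by
  rw [← pow_one (Polynomial.X), X_pow_dvd_scaleVars_iff]
  intro e he
  obtain ⟨u, v, huv, hu, hv⟩ := mem_edgeIdeal_iff.mp hf e he
  rw [Nat.one_le_iff_ne_zero, ne_eq, Finset.sum_eq_zero_iff]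
  rcases hW u v huv with h | h
  · exact fun h0 => hu (h0 u h)
  · exact fun h0 => hv (h0 v h)

theorem X_pow_dvd_scaleVars_of_mem {G : SimpleGraph V} {W : Finset V} (hW : IsCover G W) {s : ℕ}
    {f : MvPolynomial V K} (hf : f ∈ edgeIdeal K G ^ s) :
    Polynomial.X ^ s ∣ scaleVars K W f := by
  have h1 : edgeIdeal K G ≤ (Ideal.span {Polynomial.X}).comap (scaleVars K W) := fun g hg =>
    Ideal.mem_span_singleton.mpr (X_dvd_scaleVars_of_mem hW hg)
  have h2 := (Ideal.pow_right_mono h1 s).trans (Ideal.le_comap_pow _ s) hf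
  rwa [Ideal.mem_comap, Ideal.span_singleton_pow, Ideal.mem_span_singleton] at h2

variable [Finite V]

theorem le_sum_of_mem_symbolicPower_of_minimal {G : SimpleGraph V} {W : Finset V}
    (hW : IsCover G W) (hmin : ∀ w ∈ W, ∃ u, G.Adj w u ∧ u ∉ W) {s : ℕ}
    {f : MvPolynomial V K} (hf : f ∈ symbolicPower (edgeIdeal K G) s) {e : V →₀ ℕ}
    (he : e ∈ f.support) : s ≤ ∑ w ∈ W, e w := by
  classical
  cases nonempty_fintype V
  set P : Ideal (MvPolynomial V K) := (Ideal.span {Polynomial.X}).comap (scaleVars K W) with hPdef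
  have hXp : Prime (Polynomial.X : Polynomial (MvPolynomial V K)) := Polynomial.prime_X
  have hmem : ∀ g, g ∈ P ↔ Polynomial.X ∣ scaleVars K W g := fun g => by
    rw [hPdef, Ideal.mem_comap, Ideal.mem_span_singleton]
  have : (Ideal.span {(Polynomial.X : Polynomial (MvPolynomial V K))}).IsPrime :=
    (Ideal.span_singleton_prime hXp.ne_zero).mpr hXp
  have : P.IsPrime := Ideal.comap_isPrime _ _
  have hXP : ∀ v, X v ∈ P → v ∈ W := by
    intro v hv
    by_contra hvW
    rw [hmem, ← pow_one (Polynomial.X), X_pow_dvd_scaleVars_iff] at hv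
    have := hv (Finsupp.single v 1) (by simp [X, support_monomial])
    rw [Finset.sum_eq_zero] at this
    · omega
    · intro w hw
      exact Finsupp.single_eq_of_ne (by rintro rfl; exact hvW hw)
  have hass : P ∈ associatedPrimes (MvPolynomial V K) (MvPolynomial V K ⧸ edgeIdeal K G) := by
    -- By minimality each variable of W has a neighbour among the factors, so it kills this product
    -- modulo the edge ideal.
    refine mem_associatedPrimes_quotient (∏ v ∈ Wᶜ, X v) fun h => ⟨fun hh => ?_, fun hh => ?_⟩
    · have hspan : h ∈ Ideal.span (X '' (W : Set V) : Set (MvPolynomial V K)) := by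
        rw [mem_ideal_span_X_image]
        rw [hmem, ← pow_one (Polynomial.X), X_pow_dvd_scaleVars_iff] at hh
        intro d hd
        by_contra! h0
        have := hh d hd
        rw [Finset.sum_eq_zero fun w hw => h0 w (by exact_mod_cast hw)] at this
        omega
      have hle : Ideal.span (X '' (W : Set V) : Set (MvPolynomial V K)) ≤
          (edgeIdeal K G).colon {∏ v ∈ Wᶜ, X v} := by
        rw [Ideal.span, Submodule.span_le]
        rintro _ ⟨w, hw, rfl⟩
        obtain ⟨u, hwu, hu⟩ := hmin w (by exact_mod_cast hw)
        have hu' : u ∈ Wᶜ := Finset.mem_compl.mpr hu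
        rw [SetLike.mem_coe, Submodule.mem_colon_singleton, smul_eq_mul, ← Finset.mul_prod_erase _ _ hu', ← mul_assoc]
        exact Ideal.mul_mem_right _ _ (X_mul_X_mem_edgeIdeal hwu)
      exact Submodule.mem_colon_singleton.mp (hle hspan)
    · have h1 := (hmem _).mpr (X_dvd_scaleVars_of_mem hW hh)
      refine (Ideal.IsPrime.mem_or_mem ‹P.IsPrime› h1).resolve_right fun h2 => ?_
      obtain ⟨v, hv, hvP⟩ := (Ideal.IsPrime.prod_mem_iff (hp := ‹P.IsPrime›)).mp h2
      exact Finset.mem_compl.mp hv (hXP v hvP)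
  obtain ⟨g, hg, hgf⟩ := mem_symbolicPower_iff.mp hf P hass
  have h1 := X_pow_dvd_scaleVars_of_mem hW hgf
  rw [map_mul] at h1
  have h2 := hXp.pow_dvd_of_dvd_mul_left s (fun h => hg ((hmem g).mpr h)) h1
  exact X_pow_dvd_scaleVars_iff.mp h2 e he

theorem le_sum_of_mem_symbolicPower {G : SimpleGraph V} {W : Finset V}
    (hW : IsCover G W) {s : ℕ} {f : MvPolynomial V K}
    (hf : f ∈ symbolicPower (edgeIdeal K G) s) {e : V →₀ ℕ}
    (he : e ∈ f.support) : s ≤ ∑ w ∈ W, e w := by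
  classical
  induction W using Finset.strongInduction with
  | H W ih =>
    by_cases hmin : ∀ w ∈ W, ∃ u, G.Adj w u ∧ u ∉ W
    · exact le_sum_of_mem_symbolicPower_of_minimal hW hmin hf he
    · push Not at hmin
      obtain ⟨w, hw, hmin⟩ := hmin
      -- A vertex whose neighbours all lie in W is redundant, and erasing it cannot raise the
      -- weight.
      refine (ih (W.erase w) (Finset.erase_ssubset hw) fun u v huv => ?_).trans
        (Finset.sum_le_sum_of_subset (Finset.erase_subset w W))
      have := huv.ne
      have := hW u v huv
      have := hmin u
      have := hmin v
      have := huv.symm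
      simp only [Finset.mem_erase]
      grind

end

/-! ### Combinatorics of periodic sequences. -/

theorem sum_biUnion_le {ι α : Type*} [DecidableEq α] (s : Finset ι) (W : ι → Finset α)
    (f : α → ℕ) : ∑ w ∈ s.biUnion W, f w ≤ ∑ i ∈ s, ∑ w ∈ W i, f w := by
  classical
  induction s using Finset.induction_on with
  | empty => simp
  | insert i s hi ih =>
    rw [Finset.biUnion_insert, Finset.sum_insert hi]
    have := Finset.sum_union_inter (s₁ := W i) (s₂ := s.biUnion W) (f := f)
    omega

theorem pos_of_pos_add {g : ℕ → ℕ} (h : ∀ j, g (j + 1) ≤ g j ∨ g (j + 2) = 0) (j d : ℕ)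
    (h1 : 0 < g (j + d)) (h2 : 0 < g (j + d + 1)) : 0 < g j := by
  induction d with
  | zero => exact h1
  | succ d ih =>
    have h3 := h (j + d)
    rw [← add_assoc] at h1 h2
    have h4 : g (j + d + 1 + 1) = g (j + d + 2) := rfl
    exact ih (by omega) h1

/-- Two consecutive positive values propagate backwards, hence everywhere by periodicity. Then g is
antitone, and a periodic antitone sequence is constant. -/
theorem exists_eq_const_or_eq_zero {g : ℕ → ℕ} {n : ℕ} (hn : 0 < n) (hg : Function.Periodic g n)
    (h : ∀ j, g (j + 1) ≤ g j ∨ g (j + 2) = 0) :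
    (∃ a, ∀ j, g j = a) ∨ ∀ j, g j = 0 ∨ g (j + 1) = 0 := by
  refine or_iff_not_imp_right.mpr fun hpos => ?_
  push Not at hpos
  obtain ⟨i, h1, h2⟩ := hpos
  have hper : ∀ j t, g (j + t * n) = g j := fun j t => by simpa using hg.nsmul t j
  have hall : ∀ j, 0 < g j := fun j => by
    have hle : j ≤ i + j * n := by nlinarith
    obtain ⟨d, hd⟩ := Nat.exists_eq_add_of_le hle
    refine pos_of_pos_add h j d ?_ ?_
    · rw [← hd, hper]; omega
    · rw [← hd, add_right_comm, hper]; omega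
  have hanti : Antitone g := antitone_nat_of_succ_le fun j => by
    have := h j
    have := hall (j + 2)
    omega
  refine ⟨g 0, fun j => le_antisymm (hanti (Nat.zero_le j)) ?_⟩
  have h3 := hper 0 j
  rw [zero_add] at h3
  rw [← h3]
  exact hanti (Nat.le_mul_of_pos_right j hn)

theorem succ_le_card_filter_of_periodic {k : ℕ} {p : ℕ → Prop}
    [DecidablePred p] (hp : Function.Periodic p (2 * k + 1)) (h : ∀ j, p j ∨ p (j + 1)) :
    k + 1 ≤ ((Finset.range (2 * k + 1)).filter p).card := by
  have h1 : ∑ j ∈ Finset.range (2 * k + 1), (if p (j + 1) then 1 else 0) =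
      ∑ j ∈ Finset.range (2 * k + 1), (if p j then 1 else 0) := by
    have h2 := Finset.sum_range_succ (fun j => if p j then 1 else 0) (2 * k + 1)
    rw [Finset.sum_range_succ'] at h2
    have h3 : p (2 * k + 1) = p 0 := by simpa using hp 0
    simp only [h3] at h2
    omega
  have h4 : ∑ j ∈ Finset.range (2 * k + 1), 1 ≤ ∑ j ∈ Finset.range (2 * k + 1),
      ((if p j then 1 else 0) + (if p (j + 1) then 1 else 0)) :=
    Finset.sum_le_sum fun j _ => by
      rcases h j with h | h <;> simp [h]
  rw [Finset.sum_add_distrib, h1, Finset.sum_const, Finset.card_range, smul_eq_mul] at h4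
  rw [Finset.card_filter]
  omega

/-- `G` consists of disjoint cycles `c i` of the odd lengths `2 * k i + 1`, and isolated vertices. -/
structure IsOddCycleFamily {V ι : Type*} (G : SimpleGraph V) (k : ι → ℕ) (c : ι → ℕ → V) :
    Prop where
  adj : ∀ i j, G.Adj (c i j) (c i (j + 1))
  eq_or_eq_of_adj : ∀ i j v, G.Adj (c i (j + 1)) v → v = c i j ∨ v = c i (j + 2)
  periodic : ∀ i, Function.Periodic (c i) (2 * k i + 1)
  inj : ∀ i i' j j', j < 2 * k i + 1 → j' < 2 * k i' + 1 → c i j = c i' j' → i = i' ∧ j = j'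
  exists_eq_of_adj : ∀ u v, G.Adj u v → ∃ i j, u = c i j

/-! ### Decomposing monomials along odd cycles. -/

namespace IsOddCycleFamily

variable {K : Type*} [Field K] {V ι : Type*} {G : SimpleGraph V} {k : ι → ℕ} {c : ι → ℕ → V}

theorem isCover_iff (hc : IsOddCycleFamily G k c) {W : Finset V} :
    IsCover G W ↔ ∀ i j, c i j ∈ W ∨ c i (j + 1) ∈ W := by
  refine ⟨fun h i j => h _ _ (hc.adj i j), fun h u v huv => ?_⟩
  obtain ⟨i, j, rfl⟩ := hc.exists_eq_of_adj u v huv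
  -- Adding a full period makes the index a successor, so that the vertex has a predecessor.
  have hj : c i j = c i (j + 2 * k i + 1) := (hc.periodic i j).symm
  rw [hj] at huv ⊢
  rcases hc.eq_or_eq_of_adj i _ v huv with rfl | rfl
  · exact (h i (j + 2 * k i)).symm
  · exact h i (j + 2 * k i + 1)

variable (K c k) in
/-- The product of the variables on the `i`-th cycle. -/
noncomputable def cycleProd (i : ι) : MvPolynomial V K :=
  ∏ j ∈ Finset.range (2 * k i + 1), X (c i j)

theorem cycleProd_mem (hc : IsOddCycleFamily G k c) (i : ι) :
    cycleProd K k c i ∈ edgeIdeal K G ^ k i := by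
  have key : ∀ t, ∏ j ∈ Finset.range (2 * t), (X (c i j) : MvPolynomial V K) ∈
      edgeIdeal K G ^ t := by
    intro t
    induction t with
    | zero => simp
    | succ t ih =>
      rw [mul_add, mul_one, Finset.prod_range_succ, Finset.prod_range_succ, mul_assoc, pow_succ]
      exact Ideal.mul_mem_mul ih (X_mul_X_mem_edgeIdeal (hc.adj i (2 * t)))
  rw [cycleProd, Finset.prod_range_succ]
  exact Ideal.mul_mem_right _ _ (key _)

theorem cycleProd_sq_mem (hc : IsOddCycleFamily G k c) (i : ι) :
    cycleProd K k c i ^ 2 ∈ edgeIdeal K G ^ (2 * k i + 1) := by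
  -- Rotating one factor of the square by one step pairs every vertex with its successor.
  have h1 : cycleProd K k c i = ∏ j ∈ Finset.range (2 * k i + 1), X (c i (j + 1)) := by
    have h2 := Finset.prod_range_succ (fun j => (X (c i j) : MvPolynomial V K)) (2 * k i + 1)
    rw [Finset.prod_range_succ'] at h2
    have h3 : c i (2 * k i + 1) = c i 0 := by simpa using hc.periodic i 0
    rw [h3] at h2
    exact (mul_right_cancel₀ (X_ne_zero _) h2).symm
  rw [sq]
  nth_rw 2 [h1]
  rw [cycleProd, ← Finset.prod_mul_distrib]
  have h4 := Ideal.prod_mem_prod (s := Finset.range (2 * k i + 1)) (I := fun _ => edgeIdeal K G)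
    (x := fun j => X (c i j) * X (c i (j + 1))) fun j _ => X_mul_X_mem_edgeIdeal (hc.adj i j)
  simpa using h4

theorem cycleProd_pow_mem (hc : IsOddCycleFamily G k c) (i : ι) (a : ℕ) :
    cycleProd K k c i ^ a ∈ edgeIdeal K G ^ (k i * a + a / 2) := by
  have h1 : cycleProd K k c i ^ a =
      (cycleProd K k c i ^ 2) ^ (a / 2) * cycleProd K k c i ^ (a % 2) := by
    rw [← pow_mul, ← pow_add, Nat.div_add_mod]
  have h2 : k i * a + a / 2 = (2 * k i + 1) * (a / 2) + k i * (a % 2) := by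
    conv_lhs => rw [← Nat.div_add_mod a 2]
    rw [show (2 * (a / 2) + a % 2) / 2 = a / 2 by omega]
    ring
  rw [h1, h2, pow_add, pow_mul, pow_mul]
  exact Ideal.mul_mem_mul (Ideal.pow_mem_pow (hc.cycleProd_sq_mem i) _)
    (Ideal.pow_mem_pow (hc.cycleProd_mem i) _)

theorem exists_isCover_of_const (hc : IsOddCycleFamily G k c) (e : V → ℕ) (i : ι) (a : ℕ)
    (ha : ∀ j, e (c i j) = a) :
    ∃ W : Finset V, (∀ j, c i j ∈ W ∨ c i (j + 1) ∈ W) ∧ ∑ w ∈ W, e w ≤ a * (k i + 1) := by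
  classical
  -- The even positions 0, 2, ..., 2k cover the cycle, with the last and the first adjacent.
  refine ⟨(Finset.range (k i + 1)).image fun j => c i (2 * j), fun j => ?_, ?_⟩
  · have h1 : c i (j % (2 * k i + 1)) = c i j := (hc.periodic i).map_mod_nat j
    have h2 : c i (j % (2 * k i + 1) + 1) = c i (j + 1) := by
      rw [← (hc.periodic i).map_mod_nat, Nat.mod_add_mod, (hc.periodic i).map_mod_nat]
    have h3 := Nat.mod_lt j (show 0 < 2 * k i + 1 by omega)
    rw [← h1, ← h2]
    generalize j % (2 * k i + 1) = t at h3 ⊢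
    simp only [Finset.mem_image, Finset.mem_range]
    rcases Nat.even_or_odd' t with ⟨b, rfl | rfl⟩
    · exact Or.inl ⟨b, by omega, rfl⟩
    · exact Or.inr ⟨b + 1, by omega, rfl⟩
  · refine (Finset.sum_le_card_nsmul _ _ a ?_).trans ?_
    · simp only [Finset.mem_image]
      rintro _ ⟨j, -, rfl⟩
      exact (ha _).le
    · rw [smul_eq_mul, mul_comm]
      exact Nat.mul_le_mul_left _ (Finset.card_image_le.trans_eq (Finset.card_range _))

variable [Fintype ι]

theorem prod_cycleProd_pow_dvd (hc : IsOddCycleFamily G k c) (e : V →₀ ℕ) (a : ι → ℕ)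
    (ha : ∀ i j, a i ≤ e (c i j)) :
    ∏ i, cycleProd K k c i ^ a i ∣ monomial e 1 := by
  classical
  have h1 : ∏ i, cycleProd K k c i ^ a i = monomial
      (∑ i, ∑ j ∈ Finset.range (2 * k i + 1), Finsupp.single (c i j) (a i)) 1 := by
    have : ∀ i, cycleProd K k c i ^ a i =
        ∏ j ∈ Finset.range (2 * k i + 1), monomial (Finsupp.single (c i j) (a i)) 1 := by
      intro i
      rw [cycleProd, ← Finset.prod_pow]
      simp [X_pow_eq_monomial]
    simp only [this]
    simp only [← monomial_sum_one]
  rw [h1, monomial_dvd_monomial]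
  refine ⟨Or.inr fun v => ?_, dvd_rfl⟩
  simp only [Finsupp.finsetSum_apply, Finsupp.single_apply]
  by_cases hv : ∃ i j, j < 2 * k i + 1 ∧ c i j = v
  · obtain ⟨i, j, hj, rfl⟩ := hv
    rw [Finset.sum_eq_single i, Finset.sum_eq_single j]
    · simpa using ha i j
    · intro b hb hne
      exact if_neg fun h => hne (hc.inj _ _ _ _ (Finset.mem_range.mp hb) hj h).2
    · exact fun h => absurd (Finset.mem_range.mpr hj) h
    · intro b _ hne
      exact Finset.sum_eq_zero fun d hd => if_neg fun h =>
        hne (hc.inj _ _ _ _ (Finset.mem_range.mp hd) hj h).1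
    · simp
  · push Not at hv
    rw [Finset.sum_eq_zero fun i _ => Finset.sum_eq_zero fun j hj =>
      if_neg (hv i j (Finset.mem_range.mp hj))]
    exact Nat.zero_le _

variable [Finite V]

/-- Edges are stripped off while this lowers the minimum cover weight by at most 1. When no such
edge is found, each cycle carries a constant exponent or has no two consecutive positive exponents.
-/
theorem exists_monomial_mem_pow (hc : IsOddCycleFamily G k c) (e : V →₀ ℕ) :
    ∀ s, (∀ W, IsCover G W → s ≤ ∑ w ∈ W, e w) →
    ∃ (r : ℕ) (a : ι → ℕ), s ≤ r + ∑ i, a i * (k i + 1) ∧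
      monomial e (1 : K) ∈ edgeIdeal K G ^ (r + ∑ i, (k i * a i + a i / 2)) := by
  classical
  cases nonempty_fintype V
  induction e using WellFoundedLT.induction with
  | ind e ih =>
  intro s hs
  by_cases hgood : ∃ i j, e (c i j) < e (c i (j + 1)) ∧ 0 < e (c i (j + 2))
  · obtain ⟨i, j, hlt, hpos⟩ := hgood
    set u := c i (j + 1)
    set v := c i (j + 2)
    have huv : G.Adj u v := hc.adj i (j + 1)
    have hle : Finsupp.single u 1 + Finsupp.single v 1 ≤ e := fun w => by
      have := huv.ne
      simp only [Finsupp.add_apply, Finsupp.single_apply]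
      grind
    obtain ⟨e', rfl⟩ : ∃ e', e = e' + (Finsupp.single u 1 + Finsupp.single v 1) :=
      ⟨_, (tsub_add_cancel_of_le hle).symm⟩
    have hsum : ∀ W : Finset V, ∑ w ∈ W, (e' + (Finsupp.single u 1 + Finsupp.single v 1) : V →₀ ℕ) w =
        ∑ w ∈ W, e' w + ((if u ∈ W then 1 else 0) + (if v ∈ W then 1 else 0)) := by
      intro W
      simp [Finset.sum_add_distrib, Finsupp.single_apply]
    have hlt' : e' < e' + (Finsupp.single u 1 + Finsupp.single v 1) := by
      refine lt_of_le_of_ne le_self_add fun h => ?_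
      have := DFunLike.congr_fun h u
      simp at this
    obtain ⟨r, a, h1, h2⟩ := ih e' hlt' (s - 1) fun W hW => by
      by_cases hboth : u ∈ W ∧ v ∈ W
      -- Removing the edge costs W weight 2. Trading u for its strictly lighter other neighbour
      -- gives a cover of weight at least s, so W itself had weight at least s + 1.
      · have hW' : IsCover G (insert (c i j) (W.erase u)) := by
          intro x y hxy
          have hne := hxy.ne
          have h1 := hW x y hxy
          have h2 : x = u → y = c i j ∨ y = v := by
            rintro rfl
            exact hc.eq_or_eq_of_adj i j y hxy
          have h3 : y = u → x = c i j ∨ x = v := by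
            rintro rfl
            exact hc.eq_or_eq_of_adj i j x hxy.symm
          simp only [Finset.mem_insert, Finset.mem_erase]
          grind
        have h1 := hs _ hW'
        have h2 := Finset.sum_union_inter (s₁ := {c i j}) (s₂ := W.erase u)
          (f := (e' + (Finsupp.single u 1 + Finsupp.single v 1) : V →₀ ℕ))
        rw [← Finset.insert_eq, Finset.sum_singleton] at h2
        have h3 := Finset.add_sum_erase W
          (e' + (Finsupp.single u 1 + Finsupp.single v 1) : V →₀ ℕ) hboth.1
        have h4 := hsum W
        rw [if_pos hboth.1, if_pos hboth.2] at h4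
        omega
      · have h1 := hs W hW
        rw [hsum] at h1
        split_ifs at h1 <;> grind
    refine ⟨r + 1, a, by omega, ?_⟩
    have h3 : monomial (e' + (Finsupp.single u 1 + Finsupp.single v 1)) (1 : K) =
        X u * X v * monomial e' 1 := by
      simp [X, monomial_mul, add_comm]
    rw [h3, add_right_comm, pow_succ']
    exact Ideal.mul_mem_mul (X_mul_X_mem_edgeIdeal huv) h2
  · push Not at hgood
    have hcyc : ∀ i, ∃ (a : ℕ) (W : Finset V), (∀ j, c i j ∈ W ∨ c i (j + 1) ∈ W) ∧
        ∑ w ∈ W, e w ≤ a * (k i + 1) ∧ ∀ j, a ≤ e (c i j) := by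
      intro i
      rcases exists_eq_const_or_eq_zero (g := fun j => e (c i j)) (n := 2 * k i + 1) (by omega)
        (fun j => congrArg e (hc.periodic i j))
        (fun j => by have := hgood i j; omega) with ⟨a, ha⟩ | h0
      · obtain ⟨W, h1, h2⟩ := hc.exists_isCover_of_const e i a ha
        exact ⟨a, W, h1, h2, fun j => (ha j).ge⟩
      -- The zero set of e covers this cycle at no cost.
      · refine ⟨0, Finset.univ.filter fun v => e v = 0, fun j => by simpa using h0 j, ?_, by simp⟩
        rw [Finset.sum_eq_zero fun w hw => (Finset.mem_filter.mp hw).2]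
        exact Nat.zero_le _
    choose a W h1 h2 h3 using hcyc
    refine ⟨0, a, ?_, ?_⟩
    · have h4 : IsCover G (Finset.univ.biUnion W) := hc.isCover_iff.mpr fun i j => by
        simp only [Finset.mem_biUnion, Finset.mem_univ, true_and]
        exact (h1 i j).imp (fun h => ⟨i, h⟩) fun h => ⟨i, h⟩
      rw [zero_add]
      calc s ≤ ∑ w ∈ Finset.univ.biUnion W, e w := hs _ h4
        _ ≤ ∑ i, ∑ w ∈ W i, e w := sum_biUnion_le _ _ _
        _ ≤ _ := Finset.sum_le_sum fun i _ => h2 i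
    · rw [zero_add]
      refine Ideal.mem_of_dvd _ (hc.prod_cycleProd_pow_dvd e a h3) ?_
      rw [← Finset.prod_pow_eq_pow_sum]
      exact Ideal.prod_mem_prod fun i _ => hc.cycleProd_pow_mem i (a i)

end IsOddCycleFamily

/-! ### From containments to the values of the resurgences. -/

theorem symbolicPower_antitone {R : Type*} [CommRing R] (I : Ideal R) :
    Antitone (symbolicPower I) := fun s s' hs f hf => by
  rw [mem_symbolicPower_iff] at hf ⊢
  intro P hP
  obtain ⟨g, hg, h⟩ := hf P hP
  exact ⟨g, hg, Ideal.pow_le_pow_right hs h⟩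

theorem asymptoticResurgence_le_resurgence {R : Type*} [CommRing R] (I : Ideal R) :
    asymptoticResurgence I ≤ resurgence I := by
  refine sSup_le_sSup ?_
  rintro q ⟨s, r, hs, hr, h, rfl⟩
  obtain ⟨t, ht, ht0⟩ := (h.and (eventually_gt_atTop 0)).exists
  refine ⟨s * t, r * t, by positivity, by positivity, ht, ?_⟩
  push_cast
  rw [mul_div_mul_right]
  positivity

theorem resurgence_eq_of_le_of_not_le {R : Type*} [CommRing R] {I : Ideal R} {n : ℕ} (hn : 0 < n)
    (hle : ∀ s r, r * (n + 1) < s * n → symbolicPower I s ≤ I ^ r)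
    (hnot : ∀ s r u, s ≤ (n + 1) * u → n * u < r → ¬ symbolicPower I s ≤ I ^ r) :
    resurgence I = ((((n : ℝ) + 1) / (n : ℝ) : ℝ) : EReal) ∧
    asymptoticResurgence I = ((((n : ℝ) + 1) / (n : ℝ) : ℝ) : EReal) := by
  have hn' : (0 : ℝ) < n := by exact_mod_cast hn
  have hupper : resurgence I ≤ ((((n : ℝ) + 1) / (n : ℝ) : ℝ) : EReal) := by
    refine sSup_le ?_
    rintro q ⟨s, r, hs, hr, h, rfl⟩
    have h1 := mt (hle s r) h
    rw [not_lt] at h1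
    have hr' : (0 : ℝ) < r := by exact_mod_cast hr
    rw [EReal.coe_le_coe_iff, div_le_div_iff₀ hr' hn', mul_comm ((n : ℝ) + 1)]
    exact_mod_cast h1
  have hlower : ((((n : ℝ) + 1) / (n : ℝ) : ℝ) : EReal) ≤ asymptoticResurgence I := by
    refine le_of_forall_lt fun x hx => ?_
    have hx' : max x 0 < ((((n : ℝ) + 1) / (n : ℝ) : ℝ) : EReal) :=
      max_lt hx (by exact_mod_cast (by positivity : (0 : ℝ) < ((n : ℝ) + 1) / n))
    obtain ⟨q, hq1, hq2⟩ := EReal.exists_rat_btwn_of_lt hx'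
    have hq0 : (0 : ℚ) < q := by
      have h := (le_max_right x 0).trans_lt hq1
      exact_mod_cast h
    have hnum : 0 < q.num := Rat.num_pos.mpr hq0
    obtain ⟨s, hs⟩ := Int.eq_ofNat_of_zero_le hnum.le
    have hqe : (q : ℝ) = (s : ℝ) / (q.den : ℝ) := by
      have h := Rat.cast_def (K := ℝ) q
      rw [hs] at h
      simpa using h
    refine ((le_max_left x 0).trans_lt hq1).trans_le (le_sSup
      ⟨s, q.den, by omega, q.den_pos, ?_, by exact_mod_cast congrArg Real.toEReal hqe⟩)
    have hden : (0 : ℝ) < q.den := by exact_mod_cast q.den_pos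
    have hlt : s * n < (n + 1) * q.den := by
      have h : (q : ℝ) < ((n : ℝ) + 1) / n := by exact_mod_cast hq2
      rw [hqe, div_lt_div_iff₀ hden hn'] at h
      exact_mod_cast h
    filter_upwards [eventually_gt_atTop (n * (n + 1))] with t ht
    -- This u satisfies st ≤ (n + 1)u; the bound t > n(n + 1) absorbs its rounding error.
    refine hnot _ _ (s * t / (n + 1) + 1) ?_ ?_
    · have := Nat.lt_mul_div_succ (s * t) (show 0 < n + 1 by omega)
      omega
    · have h1 : (n + 1) * (s * t / (n + 1)) ≤ s * t := Nat.mul_div_le _ _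
      have h2 : (s * n + 1) * t ≤ (n + 1) * q.den * t := Nat.mul_le_mul_right _ hlt
      refine Nat.lt_of_mul_lt_mul_left (a := n + 1) ?_
      nlinarith
  have hmid := asymptoticResurgence_le_resurgence I
  exact ⟨le_antisymm hupper (hlower.trans hmid), le_antisymm (hmid.trans hupper) hlower⟩

/-! ### Containment and non-containment for odd cycles. -/

namespace IsOddCycleFamily

variable {K : Type*} [Field K] {V ι : Type*} {G : SimpleGraph V} {k : ι → ℕ} {c : ι → ℕ → V}

theorem symbolicPower_le_pow [Finite V] [Fintype ι] (hc : IsOddCycleFamily G k c)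
    (hι : Fintype.card ι ≤ 2) (i₀ : ι) (hmin : ∀ i, k i₀ ≤ k i) {s r : ℕ}
    (h : r * (2 * k i₀ + 2) < s * (2 * k i₀ + 1)) :
    symbolicPower (edgeIdeal K G) s ≤ edgeIdeal K G ^ r := by
  intro f hf
  rw [f.as_sum]
  refine Ideal.sum_mem _ fun e he => ?_
  obtain ⟨q, a, hs, hmem⟩ := hc.exists_monomial_mem_pow (K := K) e s fun W hW =>
    le_sum_of_mem_symbolicPower hW hf he
  have hr : r ≤ q + ∑ i, (k i * a i + a i / 2) := by
    have h1 : (2 * k i₀ + 1) * ∑ i, a i * (k i + 1) ≤ (k i₀ + 1) * ∑ i, a i * (2 * k i + 1) := by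
      rw [Finset.mul_sum, Finset.mul_sum]
      refine Finset.sum_le_sum fun i _ => ?_
      have h2 : (2 * k i₀ + 1) * (k i + 1) ≤ (k i₀ + 1) * (2 * k i + 1) := by nlinarith [hmin i]
      calc _ = a i * ((2 * k i₀ + 1) * (k i + 1)) := by ring
        _ ≤ a i * ((k i₀ + 1) * (2 * k i + 1)) := Nat.mul_le_mul_left _ h2
        _ = _ := by ring
    -- Each floor loses at most 1 after doubling, and there are at most two cycles.
    have h3 : ∑ i, a i * (2 * k i + 1) ≤ 2 * ∑ i, (k i * a i + a i / 2) + 2 := by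
      have : ∑ i, a i * (2 * k i + 1) ≤ ∑ i, (2 * (k i * a i + a i / 2) + 1) :=
        Finset.sum_le_sum fun i _ => by
          rw [show a i * (2 * k i + 1) = 2 * (k i * a i) + a i by ring]
          omega
      rw [Finset.sum_add_distrib, ← Finset.mul_sum] at this
      simp only [Finset.sum_const, Finset.card_univ, smul_eq_mul, mul_one] at this
      omega
    generalize ∑ i, (k i * a i + a i / 2) = B at *
    generalize ∑ i, a i * (2 * k i + 1) = D at *
    generalize ∑ i, a i * (k i + 1) = A at *
    refine Nat.lt_succ_iff.mp (Nat.lt_of_mul_lt_mul_left (a := 2 * k i₀ + 2) ?_)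
    nlinarith
  rw [← mul_one (coeff e f), ← C_mul_monomial]
  exact Ideal.mul_mem_left _ _ (Ideal.pow_le_pow_right hr hmem)

/-- An associated prime P contains at least k i + 1 variables of the odd cycle. Each has a neighbour
outside P, and multiplying by these neighbours, which are units at P, creates k i + 1 edges. -/
theorem cycleProd_pow_mem_symbolicPower [Finite V] (hc : IsOddCycleFamily G k c) (i : ι) (t : ℕ) :
    cycleProd K k c i ^ t ∈ symbolicPower (edgeIdeal K G) ((k i + 1) * t) := by
  classical
  rw [mem_symbolicPower_iff]
  intro P hP
  have hprime : P.IsPrime := hP.isPrime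
  obtain ⟨f, hf⟩ := exists_mem_iff_mul_mem_of_mem_associatedPrimes hP
  have hcard := succ_le_card_filter_of_periodic (k := k i) (p := fun j => X (c i j) ∈ P)
    (fun j => by simp only [hc.periodic i j])
    fun j => hprime.mem_or_mem ((hf _).mpr
      (Ideal.mul_mem_right _ _ (X_mul_X_mem_edgeIdeal (hc.adj i j))))
  have hex : ∀ j, ∃ u, X (c i j) ∈ P → G.Adj (c i j) u ∧ X u ∉ P := fun j => by
    by_cases h : X (c i j) ∈ P
    · obtain ⟨u, hu⟩ := exists_adj_X_notMem_of_X_mem hf hprime.ne_top h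
      exact ⟨u, fun _ => hu⟩
    · exact ⟨c i j, fun h' => absurd h' h⟩
  choose u hu using hex
  set F := (Finset.range (2 * k i + 1)).filter fun j => (X (c i j) : MvPolynomial V K) ∈ P
  have hg : ∏ j ∈ F, X (u j) ∉ P := fun h => by
    obtain ⟨j, hj, hjP⟩ := hprime.prod_mem_iff.mp h
    exact (hu j (Finset.mem_filter.mp hj).2).2 hjP
  refine ⟨(∏ j ∈ F, X (u j)) ^ t, fun h => hg (hprime.mem_of_pow_mem _ h), ?_⟩
  rw [← mul_pow, pow_mul]
  refine Ideal.pow_mem_pow ?_ t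
  refine Ideal.pow_le_pow_right hcard ?_
  rw [cycleProd, ← Finset.prod_filter_mul_prod_filter_not (Finset.range (2 * k i + 1))
    fun j => (X (c i j) : MvPolynomial V K) ∈ P, ← mul_assoc, ← Finset.prod_mul_distrib]
  refine Ideal.mul_mem_right _ _ ?_
  have h := Ideal.prod_mem_prod (s := F) (I := fun _ => edgeIdeal K G)
    (x := fun j => X (u j) * X (c i j)) fun j hj =>
      X_mul_X_mem_edgeIdeal (hu j (Finset.mem_filter.mp hj).2).1.symm
  simpa using h

/-- A degree count: sending all variables to one variable turns each edge into its square. -/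
theorem cycleProd_pow_notMem (i : ι) {t r : ℕ} (h : (2 * k i + 1) * t < 2 * r) :
    cycleProd K k c i ^ t ∉ edgeIdeal K G ^ r := by
  intro hmem
  let φ : MvPolynomial V K →ₐ[K] Polynomial K := aeval fun _ => Polynomial.X
  have h1 : edgeIdeal K G ≤ (Ideal.span {Polynomial.X ^ 2}).comap φ := by
    rw [edgeIdeal, Ideal.span_le]
    rintro _ ⟨u, v, -, rfl⟩
    simp [φ, sq]
  have h2 := (Ideal.pow_right_mono h1 r).trans (Ideal.le_comap_pow _ r) hmem
  rw [Ideal.mem_comap, Ideal.span_singleton_pow, Ideal.mem_span_singleton, ← pow_mul] at h2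
  have h3 : φ (cycleProd K k c i ^ t) = Polynomial.X ^ ((2 * k i + 1) * t) := by
    simp [φ, cycleProd, pow_mul]
  rw [h3, pow_dvd_pow_iff Polynomial.X_ne_zero Polynomial.not_isUnit_X] at h2
  omega

theorem not_symbolicPower_le_pow [Finite V] (hc : IsOddCycleFamily G k c) (i : ι) {s r u : ℕ}
    (hs : s ≤ (2 * k i + 2) * u) (hr : (2 * k i + 1) * u < r) :
    ¬ symbolicPower (edgeIdeal K G) s ≤ edgeIdeal K G ^ r := by
  intro hle
  refine cycleProd_pow_notMem (K := K) (G := G) (k := k) (c := c) i (t := 2 * u) (r := r) ?_ (hle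
    (symbolicPower_antitone _ (hs.trans (le_of_eq ?_)) (hc.cycleProd_pow_mem_symbolicPower i _)))
  · rw [mul_left_comm]; omega
  · ring

theorem resurgence_edgeIdeal [Finite V] [Fintype ι] (hc : IsOddCycleFamily G k c)
    (hι : Fintype.card ι ≤ 2) (i₀ : ι) (hmin : ∀ i, k i₀ ≤ k i) {n : ℕ} (hn : n = 2 * k i₀ + 1) :
    resurgence (edgeIdeal K G) = ((((n : ℝ) + 1) / (n : ℝ) : ℝ) : EReal) ∧
    asymptoticResurgence (edgeIdeal K G) = ((((n : ℝ) + 1) / (n : ℝ) : ℝ) : EReal) := by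
  subst hn
  exact resurgence_eq_of_le_of_not_le (by omega)
    (fun s r h => hc.symbolicPower_le_pow hι i₀ hmin h)
    fun s r u hs hr => hc.not_symbolicPower_le_pow i₀ hs hr

end IsOddCycleFamily

/-! ### Realizing the given graphs as families of odd cycles. -/

open Fin.CommRing in
theorem IsCycleOfLength.exists_periodic {V : Type*} {G : SimpleGraph V} {n : ℕ}
    (h : IsCycleOfLength G n) : ∃ c : ℕ → V, (∀ j, G.Adj (c j) (c (j + 1))) ∧
      (∀ j v, G.Adj (c (j + 1)) v → v = c j ∨ v = c (j + 2)) ∧ Function.Periodic c n ∧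
      (∀ j j', j < n → j' < n → c j = c j' → j = j') ∧ ∀ v, ∃ j, v = c j := by
  obtain ⟨hn, ⟨e⟩⟩ := h
  obtain ⟨m, rfl⟩ : ∃ m, n = m + 2 := ⟨n - 2, by omega⟩
  refine ⟨fun j => e.symm (j : Fin (m + 2)), fun j => ?_, fun j v hv => ?_, fun j => ?_,
    fun j j' hj hj' h => ?_, fun v => ⟨(e v).val, ?_⟩⟩
  · rw [e.symm.map_adj_iff, SimpleGraph.cycleGraph_adj]
    right
    push_cast
    ring
  · obtain ⟨w, rfl⟩ := e.symm.surjective v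
    rw [e.symm.map_adj_iff, SimpleGraph.cycleGraph_adj] at hv
    refine hv.imp (fun hv => congrArg e.symm ?_) fun hv => congrArg e.symm ?_
    · push_cast at hv
      linear_combination -hv
    · push_cast at hv ⊢
      linear_combination hv
  · simp
  · have h1 := congrArg Fin.val (e.symm.injective h)
    rwa [Fin.val_natCast, Fin.val_natCast, Nat.mod_eq_of_lt hj, Nat.mod_eq_of_lt hj'] at h1
  · simp

theorem IsCycleOfLength.finite {V : Type*} {G : SimpleGraph V} {n : ℕ}
    (h : IsCycleOfLength G n) : Finite V := by
  obtain ⟨-, ⟨e⟩⟩ := h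
  exact Finite.of_equiv _ e.toEquiv.symm

theorem exists_isOddCycleFamily {V ι : Type*} {G : SimpleGraph V} {W : ι → Type*}
    {D : ∀ i, SimpleGraph (W i)} {k : ι → ℕ} (hD : ∀ i, IsCycleOfLength (D i) (2 * k i + 1))
    (f : ∀ i, W i → V) (hf : Function.Injective fun x : Σ i, W i => f x.1 x.2)
    (hG : ∀ u v, G.Adj u v ↔ ∃ i a b, (D i).Adj a b ∧ f i a = u ∧ f i b = v) :
    ∃ c, IsOddCycleFamily G k c := by
  choose c hadj hnbr hper hinj hsurj using fun i => (hD i).exists_periodic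
  refine ⟨fun i j => f i (c i j), fun i j => (hG _ _).mpr ⟨i, _, _, hadj i j, rfl, rfl⟩,
    fun i j v hv => ?_, fun i j => congrArg (f i) (hper i j), fun i i' j j' hj hj' h => ?_,
    fun u v huv => ?_⟩
  · obtain ⟨i', a, b, hab, h, rfl⟩ := (hG _ _).mp hv
    obtain ⟨rfl, h⟩ := Sigma.mk.inj_iff.mp (@hf ⟨i', a⟩ ⟨i, c i (j + 1)⟩ h)
    obtain rfl := eq_of_heq h
    exact (hnbr i' j b hab).imp (congrArg _) (congrArg _)
  · obtain ⟨rfl, h⟩ := Sigma.mk.inj_iff.mp (@hf ⟨i, c i j⟩ ⟨i', c i' j'⟩ h)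
    exact ⟨rfl, hinj i j j' hj hj' (eq_of_heq h)⟩
  · obtain ⟨i, a, b, -, rfl, -⟩ := (hG _ _).mp huv
    obtain ⟨j, rfl⟩ := hsurj i a
    exact ⟨i, j, rfl⟩

theorem resurgence_edgeIdeal_of_single_cycle {K : Type*} [Field K] {V W : Type*} [Finite V]
    {G : SimpleGraph V} {D : SimpleGraph W} {n : ℕ} (hD : IsCycleOfLength D n) (hn : Odd n)
    (f : W → V) (hf : Function.Injective f)
    (hG : ∀ u v, G.Adj u v ↔ ∃ a b, D.Adj a b ∧ f a = u ∧ f b = v) :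
    resurgence (edgeIdeal K G) = ((((n : ℝ) + 1) / (n : ℝ) : ℝ) : EReal) := by
  obtain ⟨k, rfl⟩ := hn
  obtain ⟨c, hc⟩ := exists_isOddCycleFamily (G := G) (ι := Unit) (D := fun _ => D)
    (k := fun _ => k) (fun _ => hD) (fun _ => f)
    (fun ⟨_, a⟩ ⟨_, b⟩ h => by obtain rfl : a = b := hf h; rfl) (fun u v => by simp [hG])
  exact (hc.resurgence_edgeIdeal (by simp) () (fun _ => le_rfl) rfl).1

theorem mainTheorem11 {K : Type*} [Field K] {V : Type*} (G : SimpleGraph V)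
    (C₁ C₂ : G.Subgraph) (hdisj : Disjoint C₁.verts C₂.verts) (hunion : C₁ ⊔ C₂ = ⊤)
    (n m : ℕ) (hC₁ : IsCycleOfLength C₁.coe n) (hC₂ : IsCycleOfLength C₂.coe m)
    (hn : Odd n) (hm : Odd m) (hnm : n < m) :
    resurgence (edgeIdeal K G) = ((((n : ℝ) + 1) / (n : ℝ) : ℝ) : EReal) ∧
    asymptoticResurgence (edgeIdeal K G) = ((((n : ℝ) + 1) / (n : ℝ) : ℝ) : EReal) ∧
    -- the edge ideal of `C₁` in the polynomial ring on the vertices of `C₁`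
    resurgence (edgeIdeal K C₁.coe) = ((((n : ℝ) + 1) / (n : ℝ) : ℝ) : EReal) ∧
    -- the edge ideal of `C₁` in the polynomial ring on all vertices of `G`
    resurgence (edgeIdeal K C₁.spanningCoe) = ((((n : ℝ) + 1) / (n : ℝ) : ℝ) : EReal) := by
  have hfin₁ : Finite C₁.verts := hC₁.finite
  have hfin₂ : Finite C₂.verts := hC₂.finite
  have hverts : C₁.verts ∪ C₂.verts = Set.univ := by
    rw [← SimpleGraph.Subgraph.verts_sup, hunion, SimpleGraph.Subgraph.verts_top]
  have hfin : Finite V := by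
    rw [← Set.finite_univ_iff, ← hverts]
    exact (Set.toFinite _).union (Set.toFinite _)
  have hadj : ∀ u v, G.Adj u v ↔ C₁.Adj u v ∨ C₂.Adj u v := fun u v => by
    rw [← SimpleGraph.Subgraph.sup_adj, hunion, SimpleGraph.Subgraph.top_adj]
  have hunion_eq : resurgence (edgeIdeal K G) = ((((n : ℝ) + 1) / (n : ℝ) : ℝ) : EReal) ∧
      asymptoticResurgence (edgeIdeal K G) = ((((n : ℝ) + 1) / (n : ℝ) : ℝ) : EReal) := by
    obtain ⟨k, hk⟩ := hn
    obtain ⟨l, hl⟩ := hm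
    let C : Bool → G.Subgraph := fun b => cond b C₂ C₁
    obtain ⟨c, hc⟩ := exists_isOddCycleFamily (G := G) (D := fun b => (C b).coe)
      (k := fun b => cond b l k)
      (fun b => by cases b; exacts [hk ▸ hC₁, hl ▸ hC₂])
      (fun b => Subtype.val) (fun ⟨b, x, hx⟩ ⟨b', y, hy⟩ h => by
        obtain rfl : x = y := h
        cases b <;> cases b'
        · rfl
        · exact absurd hy (Set.disjoint_left.mp hdisj hx)
        · exact absurd hx (Set.disjoint_left.mp hdisj hy)
        · rfl)
      (fun u v => by
        rw [hadj, Bool.exists_bool]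
        refine or_congr ⟨fun h => ⟨⟨u, h.fst_mem⟩, ⟨v, h.snd_mem⟩, h, rfl, rfl⟩, ?_⟩
          ⟨fun h => ⟨⟨u, h.fst_mem⟩, ⟨v, h.snd_mem⟩, h, rfl, rfl⟩, ?_⟩ <;>
        · rintro ⟨a, b, h, rfl, rfl⟩
          exact h)
    refine hc.resurgence_edgeIdeal (by simp) false (fun b => ?_) hk
    cases b
    · exact le_rfl
    · simp only [cond_true, cond_false]
      omega
  refine ⟨hunion_eq.1, hunion_eq.2, ?_, ?_⟩
  · exact resurgence_edgeIdeal_of_single_cycle hC₁ hn id Function.injective_id (by simp)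
  · refine resurgence_edgeIdeal_of_single_cycle hC₁ hn Subtype.val Subtype.val_injective
      fun u v => ⟨fun h => ?_, ?_⟩
    · have h' : C₁.Adj u v := h
      exact ⟨⟨u, h'.fst_mem⟩, ⟨v, h'.snd_mem⟩, h', rfl, rfl⟩
    · rintro ⟨a, b, h, rfl, rfl⟩
      exact h
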